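/- Let $\mathbb{R}_\ell$ be the Sorgenfrey line, that is, the set $\mathbb{R}$ with the topology generated by the half-open intervals $[a,b)$, $a<b$. Let $\mathcal{Q}(\mathbb{R}_\ell)$ be its Smyth powerdomain, namely the set of all non-empty compact saturated subsets of $\mathbb{R}_\ell$ (a set is saturated if it is the intersection of its open neighborhoods; since $\mathbb{R}_\ell$ is Hausdorff, every subset is saturated), partially ordered by reverse inclusion $\supseteq$. Then $\mathcal{Q}(\mathbb{R}_\ell)$ is sober in its Scott topology: every irreducible closed subset $C$ is the closure $\overline{\{Q\}}$ of a unique point $Q \in \mathcal{Q}(\mathbb{R}_\ell)$. Here a subset of a poset is Scott-open if it is an upper set and meets every non-empty directed set whose supremum exists and lies in it; a set $C$ is irreducible if it is non-empty and, whenever it is contained in the union of two closed sets, it is contained in one of them. -/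

import Mathlib

/-- The Sorgenfrey line: the set of real numbers with the topology generated by the half-open
intervals `[a, b)`, `a < b`. -/
def SorgenfreyLine : Type := ℝ

namespace SorgenfreyLine

instance : TopologicalSpace SorgenfreyLine :=
  TopologicalSpace.generateFrom {s : Set ℝ | ∃ a b : ℝ, a < b ∧ s = Set.Ico a b}

end SorgenfreyLine

/-- A subset of a topological space is saturated if it is the intersection of its open
neighborhoods. -/
def IsSaturatedSet {X : Type*} [TopologicalSpace X] (Q : Set X) : Prop :=
  Q = ⋂₀ {U : Set X | IsOpen U ∧ Q ⊆ U}

/-- The Smyth powerdomain of a topological space: its non-empty compact saturated subsets. -/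
structure SmythPowerdomain (X : Type*) [TopologicalSpace X] where
  carrier : Set X
  nonempty : carrier.Nonempty
  isCompact : IsCompact carrier
  isSaturated : IsSaturatedSet carrier

namespace SmythPowerdomain

variable {X : Type*} [TopologicalSpace X]

theorem carrier_injective :
    Function.Injective (SmythPowerdomain.carrier : SmythPowerdomain X → Set X) := by
  rintro ⟨_, _, _, _⟩ ⟨_, _, _, _⟩ rfl
  rfl

/-- The Smyth powerdomain is ordered by reverse inclusion. -/
instance : PartialOrder (SmythPowerdomain X) where
  le P Q := Q.carrier ⊆ P.carrier
  le_refl _ := subset_rfl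
  le_trans _ _ _ h₁ h₂ := h₂.trans h₁
  le_antisymm _ _ h₁ h₂ := carrier_injective (Set.Subset.antisymm h₂ h₁)

end SmythPowerdomain

/-- A space is sober if every irreducible closed subset is the closure of a unique point. -/
def IsSoberSpace (X : Type*) [TopologicalSpace X] : Prop :=
  ∀ C : Set X, IsIrreducible C → IsClosed C → ∃! x : X, closure {x} = C

open Set Filter Topology

/-! For an irreducible Scott-closed `C`, let `F` be the open sets that contain some member of `C`.
Since boxes are Scott-open, irreducibility makes `F` a Scott-open filter, and the Hofmann–Mislove
argument shows that `K = ⋂₀ F` is non-empty and compact with all its open neighborhoods in `F`. Each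
member of `C` contains `K`, so it remains to see that `K ∈ C`. This uses a countable neighborhood
base of `K`: members of `C` shrinking to `K` yield, after adjoining tails to `K`, an increasing
sequence in `C` with supremum `K`. In the Sorgenfrey line, right thickenings of width `1 / (n + 1)`
give such a base. -/

/-- In a Hausdorff space, a Scott-open filter of open sets contains every open neighborhood of its
intersection. -/
theorem mem_of_sInter_subset_of_scottOpen_filter {X : Type*} [TopologicalSpace X] [T2Space X]
    {F : Set (Set X)} (huniv : univ ∈ F)
    (hmono : ∀ U ∈ F, ∀ V, IsOpen V → U ⊆ V → V ∈ F)
    (hinter : ∀ U ∈ F, ∀ V ∈ F, U ∩ V ∈ F)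
    (hdir : ∀ S : Set (Set X), (∀ U ∈ S, IsOpen U) → S.Nonempty → DirectedOn (· ⊆ ·) S →
      ⋃₀ S ∈ F → ∃ U ∈ S, U ∈ F)
    {U : Set X} (hU : IsOpen U) (hFU : ⋂₀ F ⊆ U) : U ∈ F := by
  by_contra hUF
  -- Maximality of `V` outside the filter makes `Vᶜ` irreducible, hence a single point in a
  -- Hausdorff space.
  obtain ⟨V, hUV, hV⟩ := zorn_subset_nonempty {V : Set X | IsOpen V ∧ V ∉ F} (by
    intro c hc hchain hne
    refine ⟨⋃₀ c, ⟨isOpen_sUnion fun W hW ↦ (hc hW).1, fun h ↦ ?_⟩,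
      fun W hW ↦ subset_sUnion_of_mem hW⟩
    obtain ⟨W, hW, hWF⟩ := hdir c (fun W hW ↦ (hc hW).1) hne hchain.directedOn h
    exact (hc hW).2 hWF) U ⟨hU, hUF⟩
  have hadd : ∀ A, IsOpen A → ¬ A ⊆ V → V ∪ A ∈ F := by
    intro A hA hAV
    by_contra h
    exact hAV (subset_union_right.trans (hV.2 ⟨hV.1.1.union hA, h⟩ subset_union_left))
  have hirr : IsIrreducible Vᶜ := by
    refine ⟨?_, ?_⟩
    · rw [nonempty_compl]
      rintro rfl
      exact hV.1.2 huniv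
    · rintro A B hA hB ⟨a, haV, haA⟩ ⟨b, hbV, hbB⟩
      by_contra h
      have hAB : A ∩ B ⊆ V := fun x hx ↦ by
        by_contra hxV
        exact h ⟨x, hxV, hx⟩
      have h₁ := hinter _ (hadd A hA fun h ↦ haV (h haA)) _ (hadd B hB fun h ↦ hbV (h hbB))
      rw [← union_inter_distrib_left, union_eq_self_of_subset_right hAB] at h₁
      exact hV.1.2 h₁
  obtain ⟨x, hx⟩ := isIrreducible_iff_singleton.1 hirr
  have hxV : x ∉ V := by
    rw [← mem_compl_iff, hx]
    rfl
  have hxF : x ∉ ⋂₀ F := fun h ↦ hxV (hUV (hFU h))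
  simp only [mem_sInter, not_forall] at hxF
  obtain ⟨W, hW, hxW⟩ := hxF
  refine hV.1.2 (hmono W hW V hV.1.1 fun y hy ↦ ?_)
  by_contra hyV
  rw [← mem_compl_iff, hx, mem_singleton_iff] at hyV
  exact hxW (hyV ▸ hy)

/-- If compact sets `L m` are eventually contained in each neighborhood of the compact set `K`, then
the union of `K` with any tail of the sequence is compact. -/
theorem IsCompact.union_iUnion_tail {X : Type*} [TopologicalSpace X] {K : Set X}
    (hK : IsCompact K) {L : ℕ → Set X} (hL : ∀ m, IsCompact (L m))
    (hLK : ∀ U ∈ 𝓝ˢ K, ∀ᶠ m in atTop, L m ⊆ U) (n : ℕ) :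
    IsCompact (K ∪ ⋃ m ≥ n, L m) := by
  classical
  refine isCompact_of_finite_subcover fun U hU hcov ↦ ?_
  obtain ⟨t, ht⟩ := hK.elim_finite_subcover U hU (subset_union_left.trans hcov)
  have hopen : IsOpen (⋃ i ∈ t, U i) := isOpen_biUnion fun i _ ↦ hU i
  obtain ⟨N, hN⟩ := eventually_atTop.1 (hLK _ (hopen.mem_nhdsSet.2 ht))
  have hfin : IsCompact (⋃ m ∈ Finset.Ico n N, L m) :=
    (Finset.Ico n N).isCompact_biUnion fun m _ ↦ hL m
  obtain ⟨t', ht'⟩ := hfin.elim_finite_subcover U hU (by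
    refine Subset.trans ?_ hcov
    refine iUnion₂_subset fun m hm ↦ subset_union_of_subset_right ?_ _
    exact subset_biUnion_of_mem (u := fun m ↦ L m) (Finset.mem_Ico.1 hm).1)
  refine ⟨t ∪ t', ?_⟩
  rw [Finset.set_biUnion_union]
  refine union_subset (subset_union_of_subset_left ht _) (iUnion₂_subset fun m hm ↦ ?_)
  rcases lt_or_ge m N with h | h
  · refine subset_union_of_subset_right (Subset.trans ?_ ht') _
    exact subset_biUnion_of_mem (u := fun m ↦ L m) (Finset.mem_Ico.2 ⟨hm, h⟩)
  · exact subset_union_of_subset_left (hN m h) _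

theorem isSaturatedSet_of_t1 {X : Type*} [TopologicalSpace X] [T1Space X] (Q : Set X) :
    IsSaturatedSet Q := by
  refine Subset.antisymm (subset_sInter fun U hU ↦ hU.2) fun x hx ↦ ?_
  by_contra hxQ
  exact hx {x}ᶜ ⟨isOpen_compl_singleton, subset_compl_singleton_iff.2 hxQ⟩ rfl

namespace SmythPowerdomain

variable {X : Type*} [TopologicalSpace X]

theorem le_def {P Q : SmythPowerdomain X} : P ≤ Q ↔ Q.carrier ⊆ P.carrier := Iff.rfl

/-- A non-empty compact subset of a T₁ space, as a point of the Smyth powerdomain. -/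
def ofIsCompact [T1Space X] (K : Set X) (hne : K.Nonempty) (hK : IsCompact K) :
    SmythPowerdomain X :=
  ⟨K, hne, hK, isSaturatedSet_of_t1 K⟩

/-- The basic open sets of the upper Vietoris topology. -/
def box (U : Set X) : Set (SmythPowerdomain X) := {Q | Q.carrier ⊆ U}

/-- The intersection of a directed family is itself a point of the powerdomain and an upper bound,
so it lies inside the supremum; by compactness some member is already inside `U`. -/
theorem dirSupInacc_box [T2Space X] {U : Set X} (hU : IsOpen U) :
    DirSupInacc (box U : Set (SmythPowerdomain X)) := by
  intro d hne hdir a ha haU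
  have : Nonempty d := hne.to_subtype
  have hdir' : Directed (· ⊇ ·) fun Q : d ↦ Q.1.carrier := fun P Q ↦ by
    obtain ⟨R, hR, hPR, hQR⟩ := hdir P.1 P.2 Q.1 Q.2
    exact ⟨⟨R, hR⟩, hPR, hQR⟩
  have hcl : ∀ Q : d, IsClosed Q.1.carrier := fun Q ↦ Q.1.isCompact.isClosed
  have hI : (⋂ Q : d, Q.1.carrier).Nonempty :=
    IsCompact.nonempty_iInter_of_directed_nonempty_isCompact_isClosed _ hdir'
      (fun Q ↦ Q.1.nonempty) (fun Q ↦ Q.1.isCompact) hcl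
  have hIc : IsCompact (⋂ Q : d, Q.1.carrier) :=
    (Classical.arbitrary d).1.isCompact.of_isClosed_subset (isClosed_iInter hcl) (iInter_subset _ _)
  have hle : a ≤ ofIsCompact _ hI hIc :=
    ha.2 fun Q hQ ↦ iInter_subset (fun Q : d ↦ Q.1.carrier) ⟨Q, hQ⟩
  obtain ⟨Q, hQ⟩ := exists_subset_nhds_of_isCompact hdir' (fun Q ↦ Q.1.isCompact)
    fun x hx ↦ hU.mem_nhds (haU (hle hx))
  exact ⟨Q.1, Q.2, hQ⟩

theorem isOpen_box [TopologicalSpace (SmythPowerdomain X)] [IsScott (SmythPowerdomain X) univ]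
    [T2Space X] {U : Set X} (hU : IsOpen U) : IsOpen (box U : Set (SmythPowerdomain X)) := by
  rw [IsScott.isOpen_iff_isUpperSet_and_dirSupInaccOn (D := univ), dirSupInaccOn_univ]
  exact ⟨fun P Q hPQ hP ↦ Subset.trans hPQ hP, dirSupInacc_box hU⟩

/-- If a compact set has a countable neighborhood base, then its upper Vietoris neighborhoods form
a neighborhood base in the Scott topology. -/
theorem mem_of_isClosed_of_forall_box [TopologicalSpace (SmythPowerdomain X)]
    [IsScott (SmythPowerdomain X) univ] [T2Space X] {C : Set (SmythPowerdomain X)}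
    (hC : IsClosed C) {K : SmythPowerdomain X} [(𝓝ˢ K.carrier).IsCountablyGenerated]
    (hK : ∀ U, IsOpen U → K.carrier ⊆ U → (C ∩ box U).Nonempty) : K ∈ C := by
  rw [IsScott.isClosed_iff_isLowerSet_and_dirSupClosed] at hC
  obtain ⟨s, hs⟩ := (𝓝ˢ K.carrier).exists_antitone_basis
  have hex : ∀ n, ∃ Q ∈ C, Q.carrier ⊆ s n := fun n ↦ by
    obtain ⟨U, hU, hKU, hUs⟩ := mem_nhdsSet_iff_exists.1 (hs.mem n)
    obtain ⟨Q, hQ, hQU⟩ := hK U hU hKU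
    exact ⟨Q, hQ, Subset.trans hQU hUs⟩
  choose Q hQC hQs using hex
  have hev : ∀ U ∈ 𝓝ˢ K.carrier, ∀ᶠ m in atTop, (Q m).carrier ⊆ U := fun U hU ↦ by
    obtain ⟨N, hN⟩ := hs.mem_iff.1 hU
    exact eventually_atTop.2 ⟨N, fun m hm ↦ (hQs m).trans ((hs.antitone hm).trans hN)⟩
  -- The `Q n` need not be directed; the sets `L n` decrease, and `L n ≤ Q n` puts them in `C`.
  let L : ℕ → SmythPowerdomain X := fun n ↦
    ofIsCompact (K.carrier ∪ ⋃ m ≥ n, (Q m).carrier) (K.nonempty.mono subset_union_left)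
      (K.isCompact.union_iUnion_tail (fun m ↦ (Q m).isCompact) hev n)
  have hLmono : Monotone L := fun m n hmn ↦
    union_subset_union_right _ (biUnion_subset_biUnion_left fun k hk ↦ hmn.trans hk)
  have hLs : ∀ n, (L n).carrier ⊆ s n := fun n ↦
    union_subset (subset_of_mem_nhdsSet (hs.mem n))
      (iUnion₂_subset fun m hm ↦ (hQs m).trans (hs.antitone hm))
  refine hC.2 (d := range L) ?_ (range_nonempty L) hLmono.directed_le.directedOn_range ?_
  · rintro _ ⟨n, rfl⟩
    refine hC.1 (le_def.2 ?_) (hQC n)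
    exact subset_union_of_subset_right
      (subset_biUnion_of_mem (u := fun m ↦ (Q m).carrier) (le_refl n)) _
  · refine ⟨?_, fun P hP x hx ↦ ?_⟩
    · rintro _ ⟨n, rfl⟩
      exact subset_union_left
    · by_contra hxK
      have hmem : {x}ᶜ ∈ 𝓝ˢ K.carrier :=
        isOpen_compl_singleton.mem_nhdsSet.2 (subset_compl_singleton_iff.2 hxK)
      obtain ⟨n, hn⟩ := hs.mem_iff.1 hmem
      exact hn (hLs n (hP (mem_range_self n) hx)) rfl

/-- The Smyth powerdomain of a Hausdorff space whose compact sets have countable neighborhood bases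
is sober in its Scott topology. -/
theorem isSoberSpace_of_isScott [TopologicalSpace (SmythPowerdomain X)]
    [IsScott (SmythPowerdomain X) univ] [T2Space X]
    (hX : ∀ K : Set X, IsCompact K → (𝓝ˢ K).IsCountablyGenerated) :
    IsSoberSpace (SmythPowerdomain X) := by
  intro C hirr hC
  let F : Set (Set X) := {U | IsOpen U ∧ (C ∩ box U).Nonempty}
  have hmono : ∀ U ∈ F, ∀ V, IsOpen V → U ⊆ V → V ∈ F := fun U ⟨_, Q, hQ, hQU⟩ V hV hUV ↦
    ⟨hV, Q, hQ, Subset.trans hQU hUV⟩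
  have hdir : ∀ S : Set (Set X), (∀ U ∈ S, IsOpen U) → S.Nonempty → DirectedOn (· ⊆ ·) S →
      ⋃₀ S ∈ F → ∃ U ∈ S, U ∈ F := by
    rintro S hS hne hSdir ⟨-, Q, hQ, hQS⟩
    have : Nonempty S := hne.to_subtype
    obtain ⟨U, hU⟩ := Q.isCompact.elim_directed_cover (fun U : S ↦ U.1) (fun U ↦ hS U.1 U.2)
      (by rw [← sUnion_eq_iUnion]; exact hQS) hSdir.directed_val
    exact ⟨U.1, U.2, hS U.1 U.2, Q, hQ, hU⟩
  have hHM : ∀ U, IsOpen U → ⋂₀ F ⊆ U → U ∈ F := fun U hU hFU ↦ by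
    refine mem_of_sInter_subset_of_scottOpen_filter (F := F) ?_ hmono ?_ hdir
      hU hFU
    · obtain ⟨Q, hQ⟩ := hirr.1
      exact ⟨isOpen_univ, Q, hQ, subset_univ _⟩
    · rintro U ⟨hU, hCU⟩ V ⟨hV, hCV⟩
      obtain ⟨Q, hQ, hQU, hQV⟩ := hirr.2 _ _ (isOpen_box hU) (isOpen_box hV) hCU hCV
      exact ⟨hU.inter hV, Q, hQ, subset_inter hQU hQV⟩
  have hne : (⋂₀ F).Nonempty := by
    by_contra h
    obtain ⟨-, Q, -, hQ⟩ := hHM ∅ isOpen_empty (not_nonempty_iff_eq_empty.1 h).subset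
    exact Q.nonempty.ne_empty (subset_empty_iff.1 hQ)
  have hcomp : IsCompact (⋂₀ F) := by
    classical
    refine isCompact_of_finite_subcover fun {ι} U hU hcov ↦ ?_
    -- Finite subunions of the cover are directed, so one of them is already in `F` and contains `⋂₀
    -- F`.
    obtain ⟨_, ⟨t, rfl⟩, ht⟩ := hdir (range fun t : Finset ι ↦ ⋃ i ∈ t, U i)
      (by rintro _ ⟨t, rfl⟩; exact isOpen_biUnion fun i _ ↦ hU i) (range_nonempty _)
      (Monotone.directed_le (f := fun t : Finset ι ↦ ⋃ i ∈ t, U i)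
        fun s t hst ↦ biUnion_subset_biUnion_left hst).directedOn_range
      (by
        rw [sUnion_range, ← iUnion_eq_iUnion_finset]
        exact hHM _ (isOpen_iUnion hU) hcov)
    exact ⟨t, sInter_subset_of_mem ht⟩
  let K : SmythPowerdomain X := ofIsCompact (⋂₀ F) hne hcomp
  have := hX K.carrier K.isCompact
  have hKC : K ∈ C := mem_of_isClosed_of_forall_box hC fun U hU hKU ↦ (hHM U hU hKU).2
  refine ⟨K, Subset.antisymm (hC.closure_subset_iff.2 (singleton_subset_iff.2 hKC)) ?_, ?_⟩
  · intro Q hQ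
    rw [IsScott.closure_singleton, mem_Iic, le_def, Q.isSaturated]
    rintro x hx U ⟨hU, hQU⟩
    exact hx U ⟨hU, Q, hQ, hQU⟩
  · rintro P rfl
    refine le_antisymm ?_ ?_
    · rw [le_def]
      rintro x hx
      rw [P.isSaturated]
      rintro U ⟨hU, hPU⟩
      exact hx U ⟨hU, P, subset_closure rfl, hPU⟩
    · rwa [IsScott.closure_singleton] at hKC

end SmythPowerdomain

namespace SorgenfreyLine

theorem isOpen_Ico (a b : ℝ) : IsOpen (X := SorgenfreyLine) (Ico (α := ℝ) a b) := by
  rcases lt_or_ge a b with h | h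
  · exact TopologicalSpace.isOpen_generateFrom_of_mem ⟨a, b, h, rfl⟩
  · rw [Ico_eq_empty h.not_gt]
    exact isOpen_empty

theorem exists_Ico_subset {U : Set ℝ} (hU : IsOpen (X := SorgenfreyLine) U) :
    ∀ x ∈ U, ∃ ε > 0, Ico x (x + ε) ⊆ U := by
  induction hU with
  | basic s hs =>
    obtain ⟨a, b, -, rfl⟩ := hs
    intro x hx
    exact ⟨b - x, sub_pos.2 hx.2, by rw [add_sub_cancel]; exact Ico_subset_Ico_left hx.1⟩
  | univ => exact fun x _ ↦ ⟨1, one_pos, subset_univ _⟩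
  | inter s t _ _ ihs iht =>
    rintro x ⟨hxs, hxt⟩
    obtain ⟨ε, hε, hs⟩ := ihs x hxs
    obtain ⟨δ, hδ, ht⟩ := iht x hxt
    refine ⟨min ε δ, lt_min hε hδ, subset_inter (Subset.trans ?_ hs) (Subset.trans ?_ ht)⟩
    · exact Ico_subset_Ico_right (by gcongr; exact min_le_left _ _)
    · exact Ico_subset_Ico_right (by gcongr; exact min_le_right _ _)
  | sUnion S _ ih =>
    rintro x ⟨s, hs, hx⟩
    obtain ⟨ε, hε, h⟩ := ih s hs x hx
    exact ⟨ε, hε, subset_sUnion_of_subset S s h hs⟩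

instance : T2Space SorgenfreyLine := by
  have key : ∀ x y : ℝ, x < y → ∃ u v : Set SorgenfreyLine,
      IsOpen u ∧ IsOpen v ∧ x ∈ u ∧ y ∈ v ∧ Disjoint u v := fun x y hxy ↦
    ⟨Ico (α := ℝ) x y, Ico (α := ℝ) y (y + 1), isOpen_Ico _ _, isOpen_Ico _ _, ⟨le_rfl, hxy⟩,
      ⟨le_rfl, lt_add_one y⟩, disjoint_left.2 fun z hz hz' ↦ hz.2.not_ge hz'.1⟩
  refine ⟨fun x y hne ↦ ?_⟩
  rcases lt_or_gt_of_ne (α := ℝ) hne with h | h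
  · exact key x y h
  · obtain ⟨u, v, hu, hv, hy, hx, hd⟩ := key y x h
    exact ⟨v, u, hv, hu, hx, hy, hd.symm⟩

/-- The points that lie less than `δ` to the right of a point of `K`. -/
def rightThickening (K : Set ℝ) (δ : ℝ) : Set ℝ := ⋃ x ∈ K, Ico x (x + δ)

/-- A compact subset of the Sorgenfrey line has a uniform neighborhood inside each open
neighborhood. -/
theorem exists_iUnion_Ico_subset {K U : Set ℝ} (hK : IsCompact (X := SorgenfreyLine) K)
    (hU : IsOpen (X := SorgenfreyLine) U) (hKU : K ⊆ U) :
    ∃ δ > 0, rightThickening K δ ⊆ U := by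
  choose! ε hε hεU using exists_Ico_subset hU
  -- Halving `ε x` leaves room to move a further `δ ≤ ε x / 2` to the right.
  obtain ⟨t, htK, ht⟩ : ∃ t : Finset ℝ, (∀ x ∈ t, x ∈ K) ∧ K ⊆ ⋃ x ∈ t, Ico x (x + ε x / 2) :=
    hK.elim_nhds_subcover _ fun (x : ℝ) hx ↦ (isOpen_Ico x (x + ε x / 2)).mem_nhds
      ⟨le_refl x, lt_add_of_pos_right x (half_pos (hε x (hKU hx)))⟩
  obtain ⟨δ, hδ, hδt⟩ : ∃ δ > 0, ∀ x ∈ t, δ ≤ ε x / 2 := by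
    rcases t.eq_empty_or_nonempty with rfl | hne
    · exact ⟨1, one_pos, by simp⟩
    · obtain ⟨y, hy, hmin⟩ := t.exists_min_image (fun x ↦ ε x / 2) hne
      exact ⟨ε y / 2, half_pos (hε y (hKU (htK y hy))), hmin⟩
  refine ⟨δ, hδ, iUnion₂_subset fun y hy ↦ ?_⟩
  obtain ⟨x, hx, hyx⟩ := mem_iUnion₂.1 (ht hy)
  refine Subset.trans (Ico_subset_Ico hyx.1 ?_) (hεU x (hKU (htK x hx)))
  linarith [hyx.2, hδt x hx]

theorem isCountablyGenerated_nhdsSet {K : Set SorgenfreyLine} (hK : IsCompact K) :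
    (𝓝ˢ K).IsCountablyGenerated := by
  have hbasis : (𝓝ˢ K).HasBasis (fun _ : ℕ ↦ True)
      fun n ↦ rightThickening K (1 / ((n : ℝ) + 1)) := by
    refine ⟨fun V ↦ ⟨fun hV ↦ ?_, ?_⟩⟩
    · obtain ⟨U, hU, hKU, hUV⟩ := mem_nhdsSet_iff_exists.1 hV
      obtain ⟨δ, hδ, h⟩ := exists_iUnion_Ico_subset hK hU hKU
      obtain ⟨n, hn⟩ := exists_nat_one_div_lt hδ
      refine ⟨n, trivial, Subset.trans ?_ (h.trans hUV)⟩
      exact iUnion₂_mono fun x _ ↦ Ico_subset_Ico_right (add_le_add_right (α := ℝ) hn.le x)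
    · rintro ⟨n, -, h⟩
      refine mem_nhdsSet_iff_exists.2 ⟨_, isOpen_biUnion fun x _ ↦ isOpen_Ico _ _, ?_, h⟩
      exact fun x hx ↦ mem_biUnion hx
        ⟨le_refl (α := ℝ) x, lt_add_of_pos_right (α := ℝ) x Nat.one_div_pos_of_nat⟩
  exact HasCountableBasis.isCountablyGenerated ⟨hbasis, to_countable _⟩

end SorgenfreyLine

theorem mainTheorem11 :
    IsSoberSpace (Topology.WithScott (SmythPowerdomain SorgenfreyLine)) := by
  let : TopologicalSpace (SmythPowerdomain SorgenfreyLine) := scott _ univ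
  have : IsScott (SmythPowerdomain SorgenfreyLine) univ := ⟨rfl⟩
  have h : IsSoberSpace (SmythPowerdomain SorgenfreyLine) :=
    SmythPowerdomain.isSoberSpace_of_isScott fun K hK ↦
      SorgenfreyLine.isCountablyGenerated_nhdsSet hK
  exact h
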